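/- Let $p\ge 3$ be an integer and let $\Gamma_p\subset \mathrm{PSL}(2,\mathbb R)$ be the Hecke group, that is, the subgroup generated by $\iota: z\mapsto -1/z$ and $\alpha_p: z\mapsto z+2\cos(\pi/p)$. Put $\gamma_p=\iota\alpha_p$. An element $g\in\Gamma_p$ is called reciprocal if there is $r\in\Gamma_p$ with $g^{-1}=rgr^{-1}$; such an $r$ is called a reciprocator of $g$. An involution is an element $g$ with $g^2=1$ (so the identity is counted). An element of $\mathrm{PSL}(2,\mathbb R)$ is hyperbolic if the absolute value of the trace of its lifts to $\mathrm{SL}(2,\mathbb R)$ is greater than $2$. The fixed-point ratio of a hyperbolic element $A$ with lift $\begin{pmatrix} a&b\\ c&d\end{pmatrix}$ is $\theta_A=\frac{b-c}{a-d}$ if $a\ne d$, $\theta_A=\infty$ if $a=d$ and $b\neq c$, and $\theta_A=1$ if $a=d$ and $b=c$. Let $g\in\Gamma_p$. (1) Suppose that $p$ is odd. Then $g$ is reciprocal if and only if $g$ is an involution or $g$ is conjugate in $\Gamma_p$ to a hyperbolic element $h\in\Gamma_p$ with $\theta_h=0$. Moreover, for a hyperbolic $h\in\Gamma_p$, $\theta_h=0$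 if and only if the lifts of $h$ to $\mathrm{SL}(2,\mathbb R)$ are symmetric matrices. (2) Suppose that $p$ is even. Then $g$ is reciprocal if and only if $g$ is an involution or $g$ is conjugate in $\Gamma_p$ to a hyperbolic element $h\in\Gamma_p$ with $\theta_h\in\{0,1,\cos(\pi/p)\}$. Moreover, every reciprocator in $\Gamma_p$ of a hyperbolic reciprocal element of $\Gamma_p$ is conjugate in $\Gamma_p$ to $\iota$ or to $\gamma_p^{p/2}$. -/

import Mathlib

open scoped MatrixGroups

/-- `g` is reciprocal in `G` if it is conjugate in `G` to its inverse. -/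
def IsReciprocal {G : Type*} [Group G] (g : G) : Prop :=
  ∃ h : G, g⁻¹ = h * g * h⁻¹

/-- The real number `λ_p = 2 cos (π / p)`. -/
noncomputable def heckeLambda (p : ℕ) : ℝ := 2 * Real.cos (Real.pi / p)

/-- The matrix of `z ↦ -1 / z`. -/
noncomputable def iotaMatrix : SL(2, ℝ) :=
  ⟨!![0, -1; 1, 0], by simp [Matrix.det_fin_two]⟩

/-- The matrix of `z ↦ z + λ_p`. -/
noncomputable def alphaMatrix (p : ℕ) : SL(2, ℝ) :=
  ⟨!![1, heckeLambda p; 0, 1], by simp [Matrix.det_fin_two]⟩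

/-- The class in `PSL(2, ℝ)` of a matrix of `SL(2, ℝ)`. -/
def toPSL (A : SL(2, ℝ)) : PSL(2, ℝ) := QuotientGroup.mk A

/-- The Hecke group `Γ_p`, the subgroup of `PSL(2, ℝ)` generated by
`z ↦ -1 / z` and `z ↦ z + 2 cos (π / p)`. -/
noncomputable def heckeGroup (p : ℕ) : Subgroup PSL(2, ℝ) :=
  Subgroup.closure {toPSL iotaMatrix, toPSL (alphaMatrix p)}

/-- The element `ι : z ↦ -1 / z` of `Γ_p`. -/
noncomputable def heckeIota (p : ℕ) : heckeGroup p :=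
  ⟨toPSL iotaMatrix, Subgroup.subset_closure (by simp)⟩

/-- The element `α_p : z ↦ z + 2 cos (π / p)` of `Γ_p`. -/
noncomputable def heckeAlpha (p : ℕ) : heckeGroup p :=
  ⟨toPSL (alphaMatrix p), Subgroup.subset_closure (by simp)⟩

/-- The element `γ_p = ι α_p : z ↦ -1 / (z + 2 cos (π / p))` of `Γ_p`. -/
noncomputable def heckeGamma (p : ℕ) : heckeGroup p := heckeIota p * heckeAlpha p

/-- `g` is hyperbolic if its lifts to `SL(2, ℝ)` have trace of absolute value
greater than `2`. -/
def IsHyperbolicPSL (g : PSL(2, ℝ)) : Prop :=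
  ∀ A : SL(2, ℝ), toPSL A = g → 2 < |A.1.trace|

/-- The lifts of `g` to `SL(2, ℝ)` are symmetric matrices. -/
def HasSymmetricLifts (g : PSL(2, ℝ)) : Prop :=
  ∀ A : SL(2, ℝ), toPSL A = g → A.1.IsSymm

open Classical in
/-- The fixed-point ratio of a real matrix with rows `(a, b)` and `(c, d)`: it is
`(b - c) / (a - d)` if `a ≠ d`, `∞` if `a = d` and `b ≠ c`, and `1` if `a = d` and `b = c`. -/
noncomputable def matrixFixedPointRatio (M : Matrix (Fin 2) (Fin 2) ℝ) : OnePoint ℝ :=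
  if M 0 0 ≠ M 1 1 then ((M 0 1 - M 1 0) / (M 0 0 - M 1 1) : ℝ)
  else if M 0 1 ≠ M 1 0 then OnePoint.infty
  else ((1 : ℝ) : OnePoint ℝ)

theorem matrixFixedPointRatio_smul (r : ℝ) (hr : r ≠ 0) (M : Matrix (Fin 2) (Fin 2) ℝ) :
    matrixFixedPointRatio (r • M) = matrixFixedPointRatio M := by
  simp only [matrixFixedPointRatio, Matrix.smul_apply, smul_eq_mul, ne_eq,
    mul_right_inj' hr, ← mul_sub]
  rw [mul_div_mul_left _ _ hr]

/-- The fixed-point ratio of an element of `PSL(2, ℝ)`, computed from any of its lifts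
to `SL(2, ℝ)`. It is meant for hyperbolic elements. -/
noncomputable def fixedPointRatio (g : PSL(2, ℝ)) : OnePoint ℝ :=
  Quotient.liftOn' g (fun A : SL(2, ℝ) => matrixFixedPointRatio A.1) (by
    intro A B h
    rw [QuotientGroup.leftRel_apply, Matrix.SpecialLinearGroup.mem_center_iff] at h
    obtain ⟨r, hr, h⟩ := h
    have hr0 : r ≠ 0 := by
      rintro rfl
      simp at hr
    have hB : B.1 = r • A.1 := by
      have h1 : B = A * (A⁻¹ * B) := by group
      have h2 : B.1 = A.1 * (A⁻¹ * B).1 := congrArg Subtype.val h1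
      rw [h2, ← h]
      ext i j
      simp [mul_comm]
    simp only [hB, matrixFixedPointRatio_smul r hr0])

theorem fixedPointRatio_toPSL (A : SL(2, ℝ)) :
    fixedPointRatio (toPSL A) = matrixFixedPointRatio A.1 := rfl

/-!
# Reciprocal elements of the Hecke groups

Suppose `R * A * R⁻¹ = ± A⁻¹` in `SL(2, ℝ)`. Either `A` represents an involution of `PSL(2, ℝ)`, or
`R` and `R * A` both have trace `0` and `A` is hyperbolic (`isHyperbolicPSL_of_inv_eq_conj`).
Conversely `trace R = trace (R * A) = 0` makes `R` a reciprocator of `A` (`inv_toPSL_eq_conj`). The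
condition `trace (R * A) = 0` is linear in `A`: for `R = ι` it reads `b = c`, and for
`R = γ_p ^ (p / 2)` it reads `b - c = cos (π / p) * (a - d)`. So the theorem reduces to finding the
elements of trace `0` in `Γ_p`, and to the matrices with `a = d` or fixed-point ratio `1`.

Both rest on one positivity property. For `0 < k < p` the element `ι * γ_p ^ k` is represented by a
nonnegative matrix whose entries are values `sin (j π / p) / sin (π / p)`, so they are `0` or at
least `1`, and at least `1` on the diagonal. These properties pass to products
(`IsSpreadPositive`), hence to all words in the letters `ι * γ_p ^ k`. Every element of `Γ_p` is
such a word up to factors `ι` at its ends, and after cyclic reduction it is conjugate to `ι`, to a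
power of `γ_p`, or to such a word. Words have trace at least `2`, so the elements of trace `0` are
the conjugates of `ι` and, for even `p`, of `γ_p ^ (p / 2)` (`isConj_of_trace_eq_zero`). This takes
the place of the torsion theorem for the free product of cyclic groups of orders `2` and `p`.

The same normal form shows that lower left entries of matrices of `Γ_p` are `0` or at least `1` in
absolute value, and that `∞` is not fixed by a hyperbolic element. For odd `p`, the point `1` is
equivalent to `∞`, so there is no hyperbolic symmetric matrix with `a = d`
(`zero_zero_ne_one_one_of_odd`). For even `p`, `ι * γ_p ^ (p / 2)` is a hyperbolic element with axis
from `-1` to `1`; an element `A` with `b - c = a - d` fixes `-1`, and if it did not fix `1` as well,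
conjugating the commutator of the two by powers of `ι * γ_p ^ (p / 2)` would give parabolic
elements tending to the identity (`zero_zero_eq_one_one_of_even`).
-/

/-! ### Words in the generators -/

/-- The product of the elements `ι * γ ^ k` for `k` running through the list `L`. -/
def reducedWord {G : Type*} [Group G] (ι γ : G) (L : List ℕ) : G :=
  (L.map fun k => ι * γ ^ k).prod

section Words

variable {G : Type*} [Group G] {ι γ : G} {n : ℕ}

theorem reducedWord_nil : reducedWord ι γ [] = 1 := rfl

theorem reducedWord_cons (k : ℕ) (L : List ℕ) :
    reducedWord ι γ (k :: L) = ι * γ ^ k * reducedWord ι γ L := by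
  simp [reducedWord]

theorem reducedWord_append (L M : List ℕ) :
    reducedWord ι γ (L ++ M) = reducedWord ι γ L * reducedWord ι γ M := by
  simp [reducedWord]

/-- Left multiplication by `γ = ι * (ι * γ)` adds a letter in front of a reduced word, or changes or
removes its first letter. -/
theorem exists_reducedWord_gamma_mul (hι : ι * ι = 1) (hγ : γ ^ n = 1) (hn : 1 < n) {g : G}
    (hg : ∃ e e' : G, ∃ L : List ℕ, (e = 1 ∨ e = ι) ∧ (e' = 1 ∨ e' = ι) ∧
      (∀ k ∈ L, 0 < k ∧ k < n) ∧ g = e * reducedWord ι γ L * e') :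
    ∃ e e' : G, ∃ L : List ℕ, (e = 1 ∨ e = ι) ∧ (e' = 1 ∨ e' = ι) ∧
      (∀ k ∈ L, 0 < k ∧ k < n) ∧ γ * g = e * reducedWord ι γ L * e' := by
  obtain ⟨e, e', L, he, he', hL, rfl⟩ := hg
  have hι' (x : G) : ι * (ι * x) = x := by rw [← mul_assoc, hι, one_mul]
  rcases he with rfl | rfl
  · refine ⟨ι, e', 1 :: L, .inr rfl, he', ?_, ?_⟩
    · simp only [List.mem_cons, forall_eq_or_imp]
      exact ⟨⟨one_pos, hn⟩, hL⟩
    · simp [reducedWord_cons, mul_assoc, hι']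
  · cases L with
    | nil =>
      have h1 : ∀ k ∈ [1], 0 < k ∧ k < n := by simpa using hn
      rcases he' with rfl | rfl
      · exact ⟨_, _, [1], .inr rfl, .inr rfl, h1, by simp [reducedWord, hι']⟩
      · exact ⟨_, 1, [1], .inr rfl, .inl rfl, h1, by simp [reducedWord, hι', hι]⟩
    | cons k L =>
      simp only [List.mem_cons, forall_eq_or_imp] at hL
      obtain ⟨⟨-, hk⟩, hL⟩ := hL
      rcases Nat.lt_or_ge (k + 1) n with h | h
      · refine ⟨_, e', (k + 1) :: L, .inr rfl, he', ?_, ?_⟩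
        · simp only [List.mem_cons, forall_eq_or_imp]
          exact ⟨⟨k.succ_pos, h⟩, hL⟩
        · simp [reducedWord_cons, mul_assoc, hι', pow_succ']
      · have hkn : γ * γ ^ k = 1 := by rw [← pow_succ', show k + 1 = n by omega, hγ]
        refine ⟨1, e', L, .inl rfl, he', hL, ?_⟩
        simp only [reducedWord_cons, mul_assoc, hι', one_mul]
        rw [← mul_assoc, hkn, one_mul]

/-- In a group generated by an involution `ι` and an element `γ` with `γ ^ n = 1`, every element is
a product of letters `ι * γ ^ k` with `0 < k < n`, up to factors `ι` at the two ends. -/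
theorem exists_eq_mul_reducedWord_mul (hι : ι * ι = 1) (hγ : γ ^ n = 1) (hn : 1 < n)
    (hgen : Subgroup.closure {ι, γ} = ⊤) (g : G) :
    ∃ e e' : G, ∃ L : List ℕ, (e = 1 ∨ e = ι) ∧ (e' = 1 ∨ e' = ι) ∧
      (∀ k ∈ L, 0 < k ∧ k < n) ∧ g = e * reducedWord ι γ L * e' := by
  have hι' (x : G) : ι * (ι * x) = x := by rw [← mul_assoc, hι, one_mul]
  have hιmul (y : G) (hy : ∃ e e' : G, ∃ L : List ℕ, (e = 1 ∨ e = ι) ∧ (e' = 1 ∨ e' = ι) ∧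
      (∀ k ∈ L, 0 < k ∧ k < n) ∧ y = e * reducedWord ι γ L * e') :
      ∃ e e' : G, ∃ L : List ℕ, (e = 1 ∨ e = ι) ∧ (e' = 1 ∨ e' = ι) ∧
      (∀ k ∈ L, 0 < k ∧ k < n) ∧ ι * y = e * reducedWord ι γ L * e' := by
    obtain ⟨e, e', L, he, he', hL, rfl⟩ := hy
    rcases he with rfl | rfl
    · exact ⟨ι, e', L, .inr rfl, he', hL, by simp [mul_assoc]⟩
    · exact ⟨1, e', L, .inl rfl, he', hL, by simp [mul_assoc, hι']⟩
  have hg : g ∈ Subgroup.closure {ι, γ} := hgen ▸ Subgroup.mem_top g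
  induction hg using Subgroup.closure_induction_left with
  | one => exact ⟨1, 1, [], .inl rfl, .inl rfl, by simp, by simp [reducedWord_nil]⟩
  | mul_left x hx y _ ih =>
    rcases hx with rfl | rfl
    · exact hιmul y ih
    · exact exists_reducedWord_gamma_mul hι hγ hn ih
  | inv_mul_cancel x hx y _ ih =>
    rcases hx with rfl | rfl
    · rw [inv_eq_of_mul_eq_one_left hι]
      exact hιmul y ih
    · have hinv : x⁻¹ = x ^ (n - 1) := by
        rw [inv_eq_iff_mul_eq_one, ← pow_succ', Nat.sub_add_cancel hn.le, hγ]
      rw [hinv]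
      induction n - 1 with
      | zero => simpa using ih
      | succ j ihj =>
        rw [pow_succ', mul_assoc]
        exact exists_reducedWord_gamma_mul hι hγ hn ihj

/-- Cyclic reduction of `ι * reducedWord ι γ L`: a last letter can be moved to the front, where it
merges with the first one. -/
theorem exists_isConj_iota_mul_reducedWord (hι : ι * ι = 1) (hγ : γ ^ n = 1) (L : List ℕ)
    (hL : ∀ k ∈ L, 0 < k ∧ k < n) :
    IsConj (ι * reducedWord ι γ L) ι ∨ (∃ k < n, IsConj (ι * reducedWord ι γ L) (γ ^ k)) ∨
      ∃ M : List ℕ, (∀ k ∈ M, 0 < k ∧ k < n) ∧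
        IsConj (ι * reducedWord ι γ L) (reducedWord ι γ M) := by
  have hι' (x : G) : ι * (ι * x) = x := by rw [← mul_assoc, hι, one_mul]
  induction L using List.bidirectionalRec with
  | nil => left; rw [reducedWord_nil, mul_one]
  | singleton k =>
    right; left
    exact ⟨k, (hL k (by simp)).2, by
      rw [reducedWord_cons, reducedWord_nil, mul_one, hι']⟩
  | cons_append k L l ih =>
    have hL' : ∀ j ∈ L, 0 < j ∧ j < n := fun j hj => hL j (by simp [hj])
    have hk := hL k (by simp)
    have hl := hL l (by simp)
    have hconj : IsConj (ι * reducedWord ι γ (k :: (L ++ [l])))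
        (ι * γ ^ (l + k) * reducedWord ι γ L) := by
      rw [isConj_iff]
      refine ⟨ι * γ ^ l, ?_⟩
      simp only [reducedWord_cons, reducedWord_append, reducedWord_nil, mul_assoc, hι', pow_add]
      group
    rcases lt_trichotomy (l + k) n with h | h | h
    · refine .inr (.inr ⟨(l + k) :: L, ?_, ?_⟩)
      · simp only [List.mem_cons, forall_eq_or_imp]
        exact ⟨⟨by omega, h⟩, hL'⟩
      · rwa [reducedWord_cons]
    · rw [h, hγ, mul_one] at hconj
      rcases ih hL' with h | ⟨j, hj, h⟩ | ⟨M, hM, h⟩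
      · exact .inl (hconj.trans h)
      · exact .inr (.inl ⟨j, hj, hconj.trans h⟩)
      · exact .inr (.inr ⟨M, hM, hconj.trans h⟩)
    · refine .inr (.inr ⟨(l + k - n) :: L, ?_, ?_⟩)
      · simp only [List.mem_cons, forall_eq_or_imp]
        exact ⟨⟨by omega, by omega⟩, hL'⟩
      · have : γ ^ (l + k) = γ ^ (l + k - n) := by
          conv_lhs => rw [← Nat.sub_add_cancel h.le, pow_add, hγ, mul_one]
        rw [this] at hconj
        rwa [reducedWord_cons (l + k - n)]

/-- Conjugacy representatives in a group generated by an involution `ι` and an element `γ` with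
`γ ^ n = 1`. -/
theorem exists_isConj_reducedWord (hι : ι * ι = 1) (hγ : γ ^ n = 1) (hn : 1 < n)
    (hgen : Subgroup.closure {ι, γ} = ⊤) (g : G) :
    IsConj g ι ∨ (∃ k < n, IsConj g (γ ^ k)) ∨
      ∃ L : List ℕ, (∀ k ∈ L, 0 < k ∧ k < n) ∧ IsConj g (reducedWord ι γ L) := by
  have hinv : ι⁻¹ = ι := inv_eq_of_mul_eq_one_left hι
  obtain ⟨e, e', L, he, he', hL, rfl⟩ := exists_eq_mul_reducedWord_mul hι hγ hn hgen g
  rcases he with he | he <;> rcases he' with he' | he' <;> rw [he, he']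
  · exact .inr (.inr ⟨L, hL, by rw [one_mul, mul_one]⟩)
  · have hconj : IsConj (1 * reducedWord ι γ L * ι) (ι * reducedWord ι γ L) :=
      isConj_iff.2 ⟨ι, by group⟩
    rcases exists_isConj_iota_mul_reducedWord hι hγ L hL with h | ⟨j, hj, h⟩ | ⟨M, hM, h⟩
    · exact .inl (hconj.trans h)
    · exact .inr (.inl ⟨j, hj, hconj.trans h⟩)
    · exact .inr (.inr ⟨M, hM, hconj.trans h⟩)
  · simpa using exists_isConj_iota_mul_reducedWord hι hγ L hL
  · refine .inr (.inr ⟨L, hL, isConj_iff.2 ⟨ι, ?_⟩⟩)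
    rw [hinv]
    simp only [mul_assoc, hι, mul_one]
    rw [← mul_assoc, hι, one_mul]

end Words

/-! ### Powers of the elliptic generator -/

/-- The ratio `sin (x π / p) / sin (π / p)`; its values at integers are the entries of the powers
of the matrix of `γ_p`. -/
noncomputable def sinRatio (p : ℕ) (x : ℝ) : ℝ :=
  Real.sin (x * (Real.pi / p)) / Real.sin (Real.pi / p)

/-- The matrix of `γ_p`. -/
noncomputable def gammaMatrix (p : ℕ) : SL(2, ℝ) := iotaMatrix * alphaMatrix p

section Trigonometry

variable {p : ℕ}

theorem sin_pi_div_pos (hp : 3 ≤ p) : 0 < Real.sin (Real.pi / p) := by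
  have hp' : (3 : ℝ) ≤ p := by exact_mod_cast hp
  apply Real.sin_pos_of_pos_of_lt_pi
  · have := Real.pi_pos; positivity
  · exact div_lt_self Real.pi_pos (by linarith)

theorem cos_pi_div_pos (hp : 3 ≤ p) : 0 < Real.cos (Real.pi / p) := by
  have hp' : (3 : ℝ) ≤ p := by exact_mod_cast hp
  have hpi := Real.pi_pos
  apply Real.cos_pos_of_mem_Ioo
  have h0 : 0 < Real.pi / p := by positivity
  refine ⟨by linarith, ?_⟩
  rw [div_lt_div_iff₀ (by linarith) two_pos]
  nlinarith

theorem sinRatio_zero : sinRatio p 0 = 0 := by simp [sinRatio]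

theorem sinRatio_one (hp : 3 ≤ p) : sinRatio p 1 = 1 := by
  simp [sinRatio, (sin_pi_div_pos hp).ne']

theorem sinRatio_neg (x : ℝ) : sinRatio p (-x) = -sinRatio p x := by
  simp [sinRatio, Real.sin_neg, neg_div]

theorem sinRatio_sub (hp : 3 ≤ p) (x : ℝ) : sinRatio p (p - x) = sinRatio p x := by
  have hp0 : (p : ℝ) ≠ 0 := by positivity
  rw [sinRatio, sinRatio, sub_mul, mul_div_cancel₀ _ hp0, Real.sin_pi_sub]

theorem sinRatio_self (hp : 3 ≤ p) : sinRatio p p = 0 := by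
  have := sinRatio_sub hp 0
  rwa [sub_zero, sinRatio_zero] at this

theorem sinRatio_add_one_add (x : ℝ) :
    sinRatio p (x + 1) = heckeLambda p * sinRatio p x - sinRatio p (x - 1) := by
  simp only [sinRatio, heckeLambda, add_mul, sub_mul, one_mul, Real.sin_add, Real.sin_sub]
  ring

theorem sinRatio_add_one_sub (hp : 3 ≤ p) (x : ℝ) :
    sinRatio p (x + 1) - sinRatio p (x - 1) = 2 * Real.cos (x * (Real.pi / p)) := by
  have := (sin_pi_div_pos hp).ne'
  simp only [sinRatio, add_mul, sub_mul, one_mul, Real.sin_add, Real.sin_sub]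
  field_simp
  ring

/-- On `[π / p, π - π / p]` the sine is smallest at the endpoints. -/
theorem one_le_sinRatio (hp : 3 ≤ p) {x : ℝ} (h1 : 1 ≤ x) (h2 : x ≤ p - 1) :
    1 ≤ sinRatio p x := by
  have hp0 : (0 : ℝ) < p := by positivity
  wlog h : x ≤ p / 2 generalizing x
  · rw [← sinRatio_sub hp]
    exact this (by linarith) (by linarith) (by linarith)
  have hpi := Real.pi_pos
  rw [sinRatio, one_le_div (sin_pi_div_pos hp)]
  have h0 : 0 < Real.pi / p := by positivity
  apply Real.sin_le_sin_of_le_of_le_pi_div_two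
  · linarith
  · calc x * (Real.pi / p) ≤ p / 2 * (Real.pi / p) := by gcongr
      _ = Real.pi / 2 := by field_simp
  · nlinarith

theorem coe_iotaMatrix : iotaMatrix.1 = !![0, -1; 1, 0] := rfl

theorem coe_gammaMatrix : (gammaMatrix p).1 = !![0, -1; 1, heckeLambda p] := by
  rw [gammaMatrix, Matrix.SpecialLinearGroup.coe_mul, coe_iotaMatrix, alphaMatrix]
  simp

theorem coe_gammaMatrix_pow (hp : 3 ≤ p) (k : ℕ) :
    (gammaMatrix p ^ k).1 =
      !![-sinRatio p (k - 1), -sinRatio p k; sinRatio p k, sinRatio p (k + 1)] := by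
  induction k with
  | zero =>
    have h : sinRatio p (-1) = -1 := by rw [sinRatio_neg, sinRatio_one hp]
    ext i j
    fin_cases i <;> fin_cases j <;> simp [h, sinRatio_zero, sinRatio_one hp]
  | succ k ih =>
    have h1 := sinRatio_add_one_add (p := p) (k : ℝ)
    have h2 := sinRatio_add_one_add (p := p) (k + 1 : ℝ)
    rw [add_sub_cancel_right] at h2
    rw [pow_succ, Matrix.SpecialLinearGroup.coe_mul, ih, coe_gammaMatrix, Nat.cast_add_one]
    ext i j
    fin_cases i <;> fin_cases j <;> simp [h2] <;> linarith

theorem gammaMatrix_pow_self (hp : 3 ≤ p) : gammaMatrix p ^ p = -1 := by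
  have h1 : sinRatio p (p - 1) = 1 := by rw [sinRatio_sub hp, sinRatio_one hp]
  have h2 : sinRatio p (p + 1) = -1 := by
    have := sinRatio_sub hp (-1)
    rwa [sub_neg_eq_add, sinRatio_neg, sinRatio_one hp] at this
  apply Subtype.ext
  rw [coe_gammaMatrix_pow hp, sinRatio_self hp, h1, h2]
  ext i j
  fin_cases i <;> fin_cases j <;> simp

theorem coe_iotaMatrix_inv_mul_gammaMatrix_pow (hp : 3 ≤ p) (k : ℕ) :
    (iotaMatrix⁻¹ * gammaMatrix p ^ k).1 =
      !![sinRatio p k, sinRatio p (k + 1); sinRatio p (k - 1), sinRatio p k] := by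
  rw [Matrix.SpecialLinearGroup.coe_mul, coe_gammaMatrix_pow hp,
    Matrix.SpecialLinearGroup.coe_inv, coe_iotaMatrix, Matrix.adjugate_fin_two]
  simp

end Trigonometry

/-! ### Lifts of elements of the Hecke group -/

theorem toPSL_mul (A B : SL(2, ℝ)) : toPSL (A * B) = toPSL A * toPSL B := rfl

theorem toPSL_inv (A : SL(2, ℝ)) : toPSL A⁻¹ = (toPSL A)⁻¹ := rfl

theorem toPSL_pow (A : SL(2, ℝ)) (n : ℕ) : toPSL (A ^ n) = toPSL A ^ n := rfl

theorem toPSL_one : toPSL 1 = 1 := rfl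

theorem trace_mul_mul_inv (C A : SL(2, ℝ)) : (C * A * C⁻¹).1.trace = A.1.trace := by
  rw [Matrix.SpecialLinearGroup.coe_mul, Matrix.trace_mul_comm,
    ← Matrix.SpecialLinearGroup.coe_mul, inv_mul_cancel_left]

theorem exists_toPSL_eq (g : PSL(2, ℝ)) : ∃ A, toPSL A = g := QuotientGroup.mk_surjective g

theorem toPSL_neg (A : SL(2, ℝ)) : toPSL (-A) = toPSL A := by
  refine QuotientGroup.eq.2 ?_
  rw [Matrix.SpecialLinearGroup.mem_center_iff]
  refine ⟨-1, by simp, ?_⟩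
  have : (-A)⁻¹ * A = -1 := by
    rw [inv_mul_eq_iff_eq_mul]; simp
  rw [this]
  ext i j
  fin_cases i <;> fin_cases j <;> simp

theorem toPSL_eq_iff {A B : SL(2, ℝ)} : toPSL A = toPSL B ↔ A = B ∨ A = -B := by
  constructor
  · intro h
    have h := QuotientGroup.eq.1 h
    rw [Matrix.SpecialLinearGroup.mem_center_iff] at h
    obtain ⟨r, hr, h⟩ := h
    have hr : r = 1 ∨ r = -1 := by simpa using hr
    rcases hr with rfl | rfl
    · left
      have : A⁻¹ * B = 1 := by
        apply Subtype.ext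
        rw [← h]
        simp
      exact inv_mul_eq_one.1 this
    · right
      have : A⁻¹ * B = -1 := by
        apply Subtype.ext
        rw [← h]
        ext i j
        fin_cases i <;> fin_cases j <;> simp
      rw [inv_mul_eq_iff_eq_mul] at this
      simp [this]
  · rintro (rfl | rfl)
    · rfl
    · exact toPSL_neg B

/-- A matrix with nonnegative entries whose diagonal entries are at least `1` and whose
off-diagonal entries are zero or at least `1`. Because of the lower bound `1`, such a matrix is
not close to the identity without being equal to it. -/
structure IsSpreadPositive (A : SL(2, ℝ)) : Prop where
  one_le_zero_zero : 1 ≤ A.1 0 0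
  one_le_one_one : 1 ≤ A.1 1 1
  zero_one : A.1 0 1 = 0 ∨ 1 ≤ A.1 0 1
  one_zero : A.1 1 0 = 0 ∨ 1 ≤ A.1 1 0

theorem IsSpreadPositive.one : IsSpreadPositive 1 := by
  constructor <;> simp

theorem IsSpreadPositive.mul {A B : SL(2, ℝ)} (hA : IsSpreadPositive A)
    (hB : IsSpreadPositive B) : IsSpreadPositive (A * B) := by
  obtain ⟨ha, hd, hb, hc⟩ := hA
  obtain ⟨ha', hd', hb', hc'⟩ := hB
  constructor <;> simp only [Matrix.SpecialLinearGroup.coe_mul, Matrix.mul_apply, Fin.sum_univ_two]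
  · rcases hb with h | h <;> rcases hc' with h' | h' <;> (try rw [h]) <;> (try rw [h']) <;> nlinarith
  · rcases hc with h | h <;> rcases hb' with h' | h' <;> (try rw [h]) <;> (try rw [h']) <;> nlinarith
  · rcases hb with h | h <;> rcases hb' with h' | h' <;> rw [or_iff_not_imp_left] <;> intro h0 <;>
      (try rw [h] at h0 ⊢) <;> (try rw [h'] at h0 ⊢) <;> (try simp at h0) <;> nlinarith
  · rcases hc with h | h <;> rcases hc' with h' | h' <;> rw [or_iff_not_imp_left] <;> intro h0 <;>
      (try rw [h] at h0 ⊢) <;> (try rw [h'] at h0 ⊢) <;> (try simp at h0) <;> nlinarith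

section Hecke

variable {p : ℕ}

/-- The letter `ι * γ ^ k` is represented by a matrix with entries `sinRatio p j`,
`0 ≤ j ≤ p`. -/
theorem isSpreadPositive_letter (hp : 3 ≤ p) {k : ℕ} (hk : 0 < k) (hkp : k < p) :
    IsSpreadPositive (iotaMatrix⁻¹ * gammaMatrix p ^ k) := by
  have h1 : (1 : ℝ) ≤ k := by exact_mod_cast hk
  have h2 : (k : ℝ) + 1 ≤ p := by exact_mod_cast hkp
  have h3 : 1 ≤ sinRatio p k := one_le_sinRatio hp h1 (by linarith)
  constructor <;> rw [coe_iotaMatrix_inv_mul_gammaMatrix_pow hp]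
  · simpa using h3
  · simpa using h3
  · rcases Nat.lt_or_ge (k + 1) p with h | h
    · right
      have h : (k : ℝ) + 1 + 1 ≤ p := by exact_mod_cast h
      simpa using one_le_sinRatio hp (x := k + 1) (by linarith) (by linarith)
    · left
      have h : (k : ℝ) + 1 = p := by exact_mod_cast (by omega : k + 1 = p)
      simp [h, sinRatio_self hp]
  · rcases Nat.lt_or_ge 1 k with h | h
    · right
      have h : (1 : ℝ) + 1 ≤ k := by exact_mod_cast h
      simpa using one_le_sinRatio hp (x := k - 1) (by linarith) (by linarith)
    · left
      have h : k = 1 := by omega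
      simp [h, sinRatio_zero]

theorem iotaMatrix_mul_self : iotaMatrix * iotaMatrix = -1 := by
  apply Subtype.ext
  rw [Matrix.SpecialLinearGroup.coe_mul, coe_iotaMatrix]
  ext i j
  fin_cases i <;> fin_cases j <;> simp

theorem coe_iotaMatrix_mul (A : SL(2, ℝ)) :
    (iotaMatrix * A).1 = !![-A.1 1 0, -A.1 1 1; A.1 0 0, A.1 0 1] := by
  rw [Matrix.SpecialLinearGroup.coe_mul, coe_iotaMatrix, Matrix.eta_fin_two A.1]
  simp

theorem coe_mul_iotaMatrix (A : SL(2, ℝ)) :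
    (A * iotaMatrix).1 = !![A.1 0 1, -A.1 0 0; A.1 1 1, -A.1 1 0] := by
  rw [Matrix.SpecialLinearGroup.coe_mul, coe_iotaMatrix, Matrix.eta_fin_two A.1]
  simp

theorem coe_iotaMatrix_mul_mul_iotaMatrix (A : SL(2, ℝ)) :
    (iotaMatrix * A * iotaMatrix).1 = !![-A.1 1 1, A.1 1 0; A.1 0 1, -A.1 0 0] := by
  rw [coe_mul_iotaMatrix, coe_iotaMatrix_mul]
  simp

theorem toPSL_iotaMatrix_inv : toPSL iotaMatrix⁻¹ = toPSL iotaMatrix := by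
  rw [toPSL_eq_iff, inv_eq_iff_mul_eq_one, or_iff_not_imp_left]
  intro
  rw [inv_eq_iff_mul_eq_one, mul_neg, iotaMatrix_mul_self, neg_neg]

theorem coe_heckeIota : (heckeIota p : PSL(2, ℝ)) = toPSL iotaMatrix := rfl

theorem coe_heckeGamma_pow (k : ℕ) :
    ((heckeGamma p ^ k : heckeGroup p) : PSL(2, ℝ)) = toPSL (gammaMatrix p ^ k) := rfl

theorem heckeIota_mul_self : heckeIota p * heckeIota p = 1 := by
  apply Subtype.ext
  change toPSL (iotaMatrix * iotaMatrix) = toPSL 1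
  rw [iotaMatrix_mul_self, toPSL_neg]

theorem heckeGamma_pow_self (hp : 3 ≤ p) : heckeGamma p ^ p = 1 := by
  apply Subtype.ext
  rw [coe_heckeGamma_pow, gammaMatrix_pow_self hp, toPSL_neg]
  rfl

theorem closure_heckeIota_heckeGamma :
    Subgroup.closure {heckeIota p, heckeGamma p} = ⊤ := by
  refine eq_top_iff.2 ((Subgroup.closure_closure_coe_preimage
    (k := {toPSL iotaMatrix, toPSL (alphaMatrix p)})).ge.trans ((Subgroup.closure_le _).2 ?_))
  rintro x (hx | hx)
  · have : x = heckeIota p := Subtype.ext hx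
    exact this ▸ Subgroup.subset_closure (.inl rfl)
  · have : x = heckeAlpha p := Subtype.ext hx
    have : x = (heckeIota p)⁻¹ * heckeGamma p := by rw [this, heckeGamma, inv_mul_cancel_left]
    rw [this]
    exact mul_mem (inv_mem (Subgroup.subset_closure (.inl rfl)))
      (Subgroup.subset_closure (.inr rfl))

theorem exists_isSpreadPositive_reducedWord (hp : 3 ≤ p) (L : List ℕ)
    (hL : ∀ k ∈ L, 0 < k ∧ k < p) :
    ∃ P, IsSpreadPositive P ∧
      toPSL P = (reducedWord (heckeIota p) (heckeGamma p) L : heckeGroup p) := by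
  induction L with
  | nil => exact ⟨1, .one, rfl⟩
  | cons k L ih =>
    simp only [List.mem_cons, forall_eq_or_imp] at hL
    obtain ⟨P, hP, h⟩ := ih hL.2
    refine ⟨_, (isSpreadPositive_letter hp hL.1.1 hL.1.2).mul hP, ?_⟩
    rw [toPSL_mul, toPSL_mul, toPSL_iotaMatrix_inv, h, reducedWord_cons, Subgroup.coe_mul,
      Subgroup.coe_mul, coe_heckeIota, coe_heckeGamma_pow]

/-- Normal form of the matrices representing elements of the Hecke group: up to sign, and up to
factors `ι` on either side, they are matrices of reduced words. -/
theorem exists_isSpreadPositive_of_mem (hp : 3 ≤ p) {A : SL(2, ℝ)} (hA : toPSL A ∈ heckeGroup p) :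
    ∃ P, IsSpreadPositive P ∧ ∃ ε : ℝ, (ε = 1 ∨ ε = -1) ∧
      (A.1 = ε • P.1 ∨ A.1 = ε • !![-P.1 1 0, -P.1 1 1; P.1 0 0, P.1 0 1] ∨
        A.1 = ε • !![P.1 0 1, -P.1 0 0; P.1 1 1, -P.1 1 0] ∨
        A.1 = ε • !![-P.1 1 1, P.1 1 0; P.1 0 1, -P.1 0 0]) := by
  have key {B : SL(2, ℝ)} (h : toPSL A = toPSL B) :
      ∃ ε : ℝ, (ε = 1 ∨ ε = -1) ∧ A.1 = ε • B.1 := by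
    rcases toPSL_eq_iff.1 h with rfl | rfl
    · exact ⟨1, .inl rfl, by simp⟩
    · exact ⟨-1, .inr rfl, by simp⟩
  obtain ⟨e, e', L, he, he', hL, h⟩ := exists_eq_mul_reducedWord_mul heckeIota_mul_self
    (heckeGamma_pow_self hp) (by omega) closure_heckeIota_heckeGamma ⟨_, hA⟩
  obtain ⟨P, hP, hPL⟩ := exists_isSpreadPositive_reducedWord hp L hL
  refine ⟨P, hP, ?_⟩
  rw [← coe_iotaMatrix_mul_mul_iotaMatrix, ← coe_iotaMatrix_mul, ← coe_mul_iotaMatrix]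
  have h := congrArg Subtype.val h
  simp only [Subgroup.coe_mul, ← hPL] at h
  rcases he with rfl | rfl <;> rcases he' with rfl | rfl
  · obtain ⟨ε, hε, h⟩ := key (B := P) (by simpa using h)
    exact ⟨ε, hε, .inl h⟩
  · obtain ⟨ε, hε, h⟩ := key (B := P * iotaMatrix) (by simpa [toPSL_mul, coe_heckeIota] using h)
    exact ⟨ε, hε, .inr (.inr (.inl h))⟩
  · obtain ⟨ε, hε, h⟩ := key (B := iotaMatrix * P) (by simpa [toPSL_mul, coe_heckeIota] using h)
    exact ⟨ε, hε, .inr (.inl h)⟩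
  · obtain ⟨ε, hε, h⟩ := key (B := iotaMatrix * P * iotaMatrix)
      (by simpa [toPSL_mul, coe_heckeIota] using h)
    exact ⟨ε, hε, .inr (.inr (.inr h))⟩

/-- The Hecke group is discrete: a lower left entry cannot be small without being zero. -/
theorem one_zero_eq_zero_of_abs_lt_one (hp : 3 ≤ p) {A : SL(2, ℝ)}
    (hA : toPSL A ∈ heckeGroup p) (h : |A.1 1 0| < 1) : A.1 1 0 = 0 := by
  obtain ⟨P, ⟨h00, h11, h01, h10⟩, ε, hε, hAP⟩ := exists_isSpreadPositive_of_mem hp hA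
  rw [abs_lt] at h
  rcases hAP with hAP | hAP | hAP | hAP <;>
    simp [hAP] at h ⊢ <;>
    rcases hε with rfl | rfl <;> grind

/-- The stabilizer of `∞` in the Hecke group contains no hyperbolic element. -/
theorem abs_trace_eq_two_of_one_zero_eq_zero (hp : 3 ≤ p) {A : SL(2, ℝ)}
    (hA : toPSL A ∈ heckeGroup p) (h : A.1 1 0 = 0) : |A.1.trace| = 2 := by
  obtain ⟨P, ⟨h00, h11, h01, h10⟩, ε, hε, hAP⟩ := exists_isSpreadPositive_of_mem hp hA
  have hdet := P.2
  rw [Matrix.det_fin_two] at hdet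
  have hεne : ε ≠ 0 := by rcases hε with rfl | rfl <;> norm_num
  have habs : |ε| = 1 := by rcases hε with rfl | rfl <;> norm_num
  have fin : P.1 0 0 * P.1 1 1 = 1 → |P.1 0 0 + P.1 1 1| = 2 := by
    intro h
    have h0 : P.1 0 0 = 1 := by nlinarith
    have h1 : P.1 1 1 = 1 := by nlinarith
    rw [h0, h1]; norm_num
  rcases hAP with hAP | hAP | hAP | hAP <;>
    simp [hAP, hεne] at h
  · rw [hAP, Matrix.trace_smul, Matrix.trace_fin_two, smul_eq_mul, abs_mul, habs, one_mul]
    apply fin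
    rw [h] at hdet
    linarith
  · linarith
  · linarith
  · rw [hAP, Matrix.trace_smul, smul_eq_mul, abs_mul, habs, one_mul,
      Matrix.trace_fin_two_of, ← neg_add, abs_neg, add_comm]
    apply fin
    rw [h] at hdet
    linarith

/-- An element of the Hecke group represented by a matrix of trace `0` is conjugate to `ι` or
to the power of `γ_p` of order two. -/
theorem isConj_of_trace_eq_zero (hp : 3 ≤ p) {r : heckeGroup p} {A : SL(2, ℝ)}
    (hA : toPSL A = r) (h : A.1.trace = 0) :
    IsConj r (heckeIota p) ∨ ∃ k, p = 2 * k ∧ IsConj r (heckeGamma p ^ k) := by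
  have hpi := Real.pi_pos
  have hp0 : (0 : ℝ) < p := by positivity
  have key {g : heckeGroup p} {B : SL(2, ℝ)} (hB : toPSL B = g) (hrg : IsConj r g) :
      B.1.trace = 0 := by
    obtain ⟨c, rfl⟩ := isConj_iff.1 hrg
    obtain ⟨C, hC⟩ := exists_toPSL_eq c
    have h1 : toPSL B = toPSL (C * A * C⁻¹) := by
      simp [hB, toPSL_mul, toPSL_inv, hC, hA]
    have h2 : (C * A * C⁻¹).1.trace = 0 := by
      rw [trace_mul_mul_inv, h]
    rcases toPSL_eq_iff.1 h1 with rfl | rfl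
    · exact h2
    · simpa using h2
  rcases exists_isConj_reducedWord heckeIota_mul_self (heckeGamma_pow_self hp) (by omega)
    closure_heckeIota_heckeGamma r with h | ⟨k, hk, h⟩ | ⟨L, hL, h⟩
  · exact .inl h
  · right
    refine ⟨k, ?_, h⟩
    have h := key (coe_heckeGamma_pow k).symm h
    rw [coe_gammaMatrix_pow hp, Matrix.trace_fin_two_of] at h
    have h2 := sinRatio_add_one_sub hp k
    have h3 : Real.cos (k * (Real.pi / p)) = Real.cos (Real.pi / 2) := by
      rw [Real.cos_pi_div_two]; linarith
    have hkp : (k : ℝ) < p := by exact_mod_cast hk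
    have h4 := Real.injOn_cos (Set.mem_Icc.2 ⟨by positivity, ?_⟩)
      (Set.mem_Icc.2 ⟨by positivity, by linarith⟩) h3
    · have : (p : ℝ) = 2 * k := by
        field_simp at h4
        linarith
      exact_mod_cast this
    · calc k * (Real.pi / p) ≤ p * (Real.pi / p) := by gcongr
        _ = Real.pi := by field_simp
  -- Reduced words, the empty one included, have trace at least `2`.
  · exfalso
    obtain ⟨P, hP, hPL⟩ := exists_isSpreadPositive_reducedWord hp L hL
    have h := key hPL h
    rw [Matrix.trace_fin_two] at h
    linarith [hP.one_le_zero_zero, hP.one_le_one_one]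

end Hecke

/-! ### Reciprocators -/

/-- Comparing entries in `R * A = A⁻¹ * R` shows that `R` has trace `0` unless `A` is scalar; then
`R` has determinant `1`, which forces `A` to be hyperbolic. -/
theorem two_lt_abs_trace_of_mul_eq_inv_mul {A R : SL(2, ℝ)} (h : R * A = A⁻¹ * R) :
    (A = 1 ∨ A = -1) ∨ (2 < |A.1.trace| ∧ R.1.trace = 0 ∧
      R.1 0 0 * (A.1 0 0 - A.1 1 1) + R.1 0 1 * A.1 1 0 + R.1 1 0 * A.1 0 1 = 0) := by
  have hA := A.2
  have hR := R.2
  rw [Matrix.det_fin_two] at hA hR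
  have h := congrArg Subtype.val h
  rw [Matrix.SpecialLinearGroup.coe_mul, Matrix.SpecialLinearGroup.coe_mul,
    Matrix.SpecialLinearGroup.coe_inv, Matrix.adjugate_fin_two] at h
  have h00 := congrFun (congrFun h 0) 0
  have h01 := congrFun (congrFun h 0) 1
  have h10 := congrFun (congrFun h 1) 0
  have h11 := congrFun (congrFun h 1) 1
  simp [Matrix.mul_apply, Fin.sum_univ_two] at h00 h01 h10 h11
  rw [or_iff_not_imp_left]
  intro hne
  have hns : ¬(A.1 0 1 = 0 ∧ A.1 1 0 = 0 ∧ A.1 0 0 = A.1 1 1) := by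
    rintro ⟨hb, hc, hd⟩
    rw [hb, hd, zero_mul, sub_zero, mul_self_eq_one_iff] at hA
    rcases hA with h1 | h1 <;> rw [h1] at hd
    · exact hne (.inl (Subtype.ext (by
        rw [Matrix.eta_fin_two A.1, hb, hc, hd, h1]; exact Matrix.one_fin_two.symm)))
    · exact hne (.inr (Subtype.ext (by
        rw [Matrix.eta_fin_two A.1, hb, hc, hd, h1]
        ext i j
        fin_cases i <;> fin_cases j <;> simp)))
  rw [Matrix.trace_fin_two, Matrix.trace_fin_two]
  generalize A.1 0 0 = a, A.1 0 1 = b, A.1 1 0 = c, A.1 1 1 = d,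
    R.1 0 0 = e, R.1 0 1 = f, R.1 1 0 = g, R.1 1 1 = i at *
  have hi : e + i = 0 := by
    by_contra hei
    refine hns ⟨mul_right_cancel₀ hei ?_, mul_right_cancel₀ hei ?_,
      sub_eq_zero.1 (mul_right_cancel₀ hei ?_)⟩ <;> linarith
  obtain rfl : i = -e := by linarith
  have hbil : e * (a - d) + f * c + g * b = 0 := by linarith
  refine ⟨?_, hi, hbil⟩
  have hfg : f * g = -(1 + e ^ 2) := by linarith
  have hf : f ≠ 0 := by rintro rfl; nlinarith
  have hg : g ≠ 0 := by rintro rfl; nlinarith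
  -- The discriminant `(a - d) ^ 2 + 4 * b * c`, multiplied by `1 + e ^ 2`, is a sum of two squares.
  have hdisc : (1 + e ^ 2) * ((a + d) ^ 2 - 4) = (a - d) ^ 2 + (f * c - g * b) ^ 2 := by
    linear_combination (4 * (1 + e ^ 2)) * hA + (4 * b * c) * hfg +
      (e * (a - d) - f * c - g * b) * hbil
  have hpos : 0 < (a - d) ^ 2 + (f * c - g * b) ^ 2 := by
    by_contra hle
    have h1 : a - d = 0 := by nlinarith [sq_nonneg (a - d), sq_nonneg (f * c - g * b)]
    have h2 : f * c - g * b = 0 := by nlinarith [sq_nonneg (a - d), sq_nonneg (f * c - g * b)]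
    rw [h1] at hbil
    have h3 : f * c = 0 := by linarith
    have h4 : g * b = 0 := by linarith
    exact hns ⟨(mul_eq_zero.1 h4).resolve_left hg, (mul_eq_zero.1 h3).resolve_left hf,
      sub_eq_zero.1 h1⟩
  rw [← hdisc] at hpos
  have h4 : (2 : ℝ) ^ 2 < (a + d) ^ 2 := by
    have := pos_of_mul_pos_right hpos (by positivity)
    linarith
  simpa using sq_lt_sq.1 h4

theorem mul_eq_inv_mul_of_trace_eq_zero {A R : SL(2, ℝ)} (hR : R.1.trace = 0)
    (h : R.1 0 0 * (A.1 0 0 - A.1 1 1) + R.1 0 1 * A.1 1 0 + R.1 1 0 * A.1 0 1 = 0) :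
    R * A = A⁻¹ * R := by
  rw [Matrix.trace_fin_two] at hR
  have hR' : R.1 1 1 = -R.1 0 0 := by linarith
  apply Subtype.ext
  rw [Matrix.SpecialLinearGroup.coe_mul, Matrix.SpecialLinearGroup.coe_mul,
    Matrix.SpecialLinearGroup.coe_inv, Matrix.adjugate_fin_two]
  ext i j
  fin_cases i <;> fin_cases j <;> simp [Matrix.mul_apply, Fin.sum_univ_two, hR'] <;> linarith

theorem mul_self_eq_neg_one_of_trace_eq_zero {A : SL(2, ℝ)} (h : A.1.trace = 0) :
    A * A = -1 := by
  have hA := A.2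
  rw [Matrix.det_fin_two] at hA
  rw [Matrix.trace_fin_two] at h
  have h' : A.1 1 1 = -A.1 0 0 := by linarith
  rw [h'] at hA
  apply Subtype.ext
  rw [Matrix.SpecialLinearGroup.coe_mul]
  ext i j
  fin_cases i <;> fin_cases j <;> simp [Matrix.mul_apply, Fin.sum_univ_two, h'] <;> linarith

theorem isHyperbolicPSL_toPSL {A : SL(2, ℝ)} :
    IsHyperbolicPSL (toPSL A) ↔ 2 < |A.1.trace| := by
  refine ⟨fun h => h A rfl, fun h B hB => ?_⟩
  rcases toPSL_eq_iff.1 hB with rfl | rfl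
  · exact h
  · simpa using h

theorem IsHyperbolicPSL.sq_ne_one {g : PSL(2, ℝ)} (hg : IsHyperbolicPSL g) : g ^ 2 ≠ 1 := by
  obtain ⟨A, rfl⟩ := exists_toPSL_eq g
  rw [isHyperbolicPSL_toPSL] at hg
  intro h
  have hA := A.2
  rw [Matrix.det_fin_two] at hA
  rw [← toPSL_pow, ← toPSL_one, toPSL_eq_iff, pow_two] at h
  -- The Cayley–Hamilton relation `A * A = trace A • A - 1` in diagonal entries.
  have hoff : A.1 0 1 * A.1.trace = 0 ∧ A.1 0 0 * A.1.trace = A.1 1 1 * A.1.trace := by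
    rw [Matrix.trace_fin_two]
    rcases h with h | h <;> have h := congrArg Subtype.val h <;>
      rw [Matrix.SpecialLinearGroup.coe_mul] at h <;>
      have h00 := congrFun (congrFun h 0) 0 <;> have h01 := congrFun (congrFun h 0) 1 <;>
      have h11 := congrFun (congrFun h 1) 1 <;>
      simp [Matrix.mul_apply, Fin.sum_univ_two] at h00 h01 h11 <;>
      constructor <;> linarith
  have ht : A.1.trace ≠ 0 := by
    intro h0
    rw [h0] at hg
    norm_num at hg
  have h01 := (mul_eq_zero.1 hoff.1).resolve_right ht
  have hd := mul_right_cancel₀ ht hoff.2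
  rw [Matrix.trace_fin_two] at hg
  rw [h01, hd, zero_mul, sub_zero, mul_self_eq_one_iff] at hA
  rcases hA with h1 | h1 <;> rw [hd, h1] at hg <;> norm_num at hg

/-- A reciprocator of an element of order other than `1` and `2` is elliptic of order two, and
the element is hyperbolic. The last equation says that `R * A` has trace `0` as well. -/
theorem isHyperbolicPSL_of_inv_eq_conj {g r : PSL(2, ℝ)} (h : g⁻¹ = r * g * r⁻¹) (hg : g ^ 2 ≠ 1) :
    IsHyperbolicPSL g ∧ ∀ A R, toPSL A = g → toPSL R = r → R.1.trace = 0 ∧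
      R.1 0 0 * (A.1 0 0 - A.1 1 1) + R.1 0 1 * A.1 1 0 + R.1 1 0 * A.1 0 1 = 0 := by
  suffices H : ∀ A R, toPSL A = g → toPSL R = r → 2 < |A.1.trace| ∧ R.1.trace = 0 ∧
      R.1 0 0 * (A.1 0 0 - A.1 1 1) + R.1 0 1 * A.1 1 0 + R.1 1 0 * A.1 0 1 = 0 by
    refine ⟨fun A hA => ?_, fun A R hA hR => (H A R hA hR).2⟩
    obtain ⟨R, hR⟩ := exists_toPSL_eq r
    exact (H A R hA hR).1
  rintro A R rfl rfl
  have h : toPSL (A⁻¹ * R) = toPSL (R * A) := by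
    rw [toPSL_mul, toPSL_inv, h, inv_mul_cancel_right, toPSL_mul]
  have hsq : ¬(A = 1 ∨ A = -1) := by
    rintro (rfl | rfl)
    · exact hg (by rw [← toPSL_pow, one_pow, toPSL_one])
    · exact hg (by rw [← toPSL_pow, neg_one_sq, toPSL_one])
  rcases toPSL_eq_iff.1 h with h | h
  · exact (two_lt_abs_trace_of_mul_eq_inv_mul h.symm).resolve_left hsq
  · exfalso
    -- Here `A⁻¹` is conjugate to `-A`, so that `A` has trace `0`.
    have h1 : A⁻¹ = -(R * A * R⁻¹) := by
      rw [← neg_mul, ← h, mul_inv_cancel_right]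
    have h2 : A⁻¹.1.trace = A.1.trace := by
      rw [Matrix.SpecialLinearGroup.coe_inv, Matrix.adjugate_fin_two, Matrix.trace_fin_two_of,
        Matrix.trace_fin_two, add_comm]
    have h4 : A.1.trace = 0 := by
      rw [h1, Matrix.SpecialLinearGroup.coe_neg, Matrix.trace_neg,
        trace_mul_mul_inv] at h2
      linarith
    apply hg
    rw [← toPSL_pow, pow_two, mul_self_eq_neg_one_of_trace_eq_zero h4, toPSL_neg, toPSL_one]

theorem inv_toPSL_eq_conj {A R : SL(2, ℝ)} (hR : R.1.trace = 0)
    (h : R.1 0 0 * (A.1 0 0 - A.1 1 1) + R.1 0 1 * A.1 1 0 + R.1 1 0 * A.1 0 1 = 0) :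
    (toPSL A)⁻¹ = toPSL R * toPSL A * (toPSL R)⁻¹ := by
  rw [← toPSL_inv, ← toPSL_inv, ← toPSL_mul, ← toPSL_mul,
    mul_eq_inv_mul_of_trace_eq_zero hR h, mul_inv_cancel_right]

theorem IsReciprocal.of_isConj {G : Type*} [Group G] {g h : G} (hh : IsReciprocal h)
    (hgh : IsConj g h) : IsReciprocal g := by
  obtain ⟨c, rfl⟩ := isConj_iff.1 hgh
  obtain ⟨r, hr⟩ := hh
  refine ⟨c⁻¹ * r * c, ?_⟩
  calc g⁻¹ = c⁻¹ * (c * g * c⁻¹)⁻¹ * c := by group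
    _ = _ := by rw [hr]; group

theorem exists_isConj_inv_eq_conj {G : Type*} [Group G] {g r r' : G} (h : g⁻¹ = r * g * r⁻¹)
    (hr : IsConj r r') (hg : g ^ 2 ≠ 1) :
    ∃ g', IsConj g g' ∧ g'⁻¹ = r' * g' * r'⁻¹ ∧ g' ^ 2 ≠ 1 := by
  obtain ⟨c, rfl⟩ := isConj_iff.1 hr
  refine ⟨c * g * c⁻¹, isConj_iff.2 ⟨c, rfl⟩, ?_, ?_⟩
  · calc (c * g * c⁻¹)⁻¹ = c * g⁻¹ * c⁻¹ := by group
      _ = _ := by rw [h]; group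
  · rw [conj_pow]
    simpa using hg

section Hecke

variable {p : ℕ}

theorem isReciprocal_of_symm {h : heckeGroup p} {A : SL(2, ℝ)} (hA : toPSL A = h)
    (hs : A.1 0 1 = A.1 1 0) : IsReciprocal h := by
  refine ⟨heckeIota p, Subtype.ext ?_⟩
  have := inv_toPSL_eq_conj (A := A) (R := iotaMatrix) (by simp [coe_iotaMatrix])
    (by simp [coe_iotaMatrix, hs])
  rw [hA] at this
  exact this

theorem symm_of_inv_eq_conj_heckeIota {h : heckeGroup p} {A : SL(2, ℝ)} (hA : toPSL A = h)
    (hh : h⁻¹ = heckeIota p * h * (heckeIota p)⁻¹) (hsq : h ^ 2 ≠ 1) : A.1 0 1 = A.1 1 0 := by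
  have hh' := congrArg Subtype.val hh
  have := ((isHyperbolicPSL_of_inv_eq_conj hh' (fun h0 => hsq (Subtype.ext h0))).2 A iotaMatrix
    hA rfl).2
  simp [coe_iotaMatrix] at this
  linarith

theorem sinRatio_half_sub_one (hp : 3 ≤ p) {k : ℕ} (hk : p = 2 * k) :
    sinRatio p (k - 1) = Real.cos (Real.pi / p) * sinRatio p k := by
  have h1 := sinRatio_add_one_add (p := p) k
  have h2 := sinRatio_sub hp (k - 1)
  have hk' : (p : ℝ) = 2 * k := by exact_mod_cast hk
  rw [show (p : ℝ) - (k - 1) = k + 1 by rw [hk']; ring] at h2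
  rw [heckeLambda] at h1
  linarith

theorem sinRatio_half_add_one (hp : 3 ≤ p) {k : ℕ} (hk : p = 2 * k) :
    sinRatio p (k + 1) = Real.cos (Real.pi / p) * sinRatio p k := by
  have h1 := sinRatio_add_one_add (p := p) k
  rw [sinRatio_half_sub_one hp hk, heckeLambda] at h1
  linarith

theorem one_le_sinRatio_half (hp : 3 ≤ p) {k : ℕ} (hk : p = 2 * k) : 1 ≤ sinRatio p k := by
  have h1 : (1 : ℝ) ≤ k := by exact_mod_cast (by omega : 1 ≤ k)
  have hk' : (p : ℝ) = 2 * k := by exact_mod_cast hk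
  exact one_le_sinRatio hp h1 (by linarith)

theorem isReciprocal_of_sub_eq_cos_mul (hp : 3 ≤ p) {k : ℕ} (hk : p = 2 * k) {h : heckeGroup p}
    {A : SL(2, ℝ)} (hA : toPSL A = h)
    (hs : A.1 0 1 - A.1 1 0 = Real.cos (Real.pi / p) * (A.1 0 0 - A.1 1 1)) :
    IsReciprocal h := by
  refine ⟨heckeGamma p ^ k, Subtype.ext ?_⟩
  have := inv_toPSL_eq_conj (A := A) (R := gammaMatrix p ^ k)
    (by
      rw [coe_gammaMatrix_pow hp, Matrix.trace_fin_two_of, sinRatio_half_sub_one hp hk,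
        sinRatio_half_add_one hp hk]
      ring)
    (by
      rw [coe_gammaMatrix_pow hp, sinRatio_half_sub_one hp hk]
      simp
      linear_combination sinRatio p k * hs)
  rw [← coe_heckeGamma_pow, hA] at this
  exact this

theorem sub_eq_cos_mul_of_inv_eq_conj_heckeGamma_pow (hp : 3 ≤ p) {k : ℕ} (hk : p = 2 * k)
    {h : heckeGroup p} {A : SL(2, ℝ)} (hA : toPSL A = h)
    (hh : h⁻¹ = heckeGamma p ^ k * h * (heckeGamma p ^ k)⁻¹) (hsq : h ^ 2 ≠ 1) :
    A.1 0 1 - A.1 1 0 = Real.cos (Real.pi / p) * (A.1 0 0 - A.1 1 1) := by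
  have hh' := congrArg Subtype.val hh
  have := ((isHyperbolicPSL_of_inv_eq_conj hh' (fun h0 => hsq (Subtype.ext h0))).2 A
    (gammaMatrix p ^ k) hA rfl).2
  rw [coe_gammaMatrix_pow hp, sinRatio_half_sub_one hp hk] at this
  simp at this
  have hs := one_le_sinRatio_half hp hk
  apply mul_left_cancel₀ (show sinRatio p k ≠ 0 by linarith)
  linear_combination this

/-! ### Axes ending at `1` or `-1` -/

/-- For odd `p` the point `1` is a cusp of the Hecke group, so that it is not fixed by a hyperbolic
element. -/
theorem zero_zero_ne_one_one_of_odd (hp : 3 ≤ p) (hodd : Odd p) {A : SL(2, ℝ)}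
    (hA : toPSL A ∈ heckeGroup p) (hhyp : 2 < |A.1.trace|) (hs : A.1 0 1 = A.1 1 0) :
    A.1 0 0 ≠ A.1 1 1 := by
  intro hd
  obtain ⟨k, hk⟩ := hodd
  -- `V` maps `∞` to `1`.
  obtain ⟨V, hV⟩ : ∃ V, V = iotaMatrix⁻¹ * gammaMatrix p ^ (k + 1) := ⟨_, rfl⟩
  have hVmem : toPSL V ∈ heckeGroup p := by
    rw [hV, toPSL_mul, toPSL_iotaMatrix_inv, ← coe_heckeIota (p := p), ← coe_heckeGamma_pow]
    exact mul_mem (SetLike.coe_mem _) (SetLike.coe_mem _)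
  have hcol : V.1 1 0 = V.1 0 0 := by
    have h := sinRatio_sub hp k
    have hk' : (p : ℝ) = 2 * k + 1 := by exact_mod_cast hk
    rw [show (p : ℝ) - k = k + 1 by rw [hk']; ring] at h
    rw [hV, coe_iotaMatrix_inv_mul_gammaMatrix_pow hp]
    simp [h]
  have hmem : toPSL (V⁻¹ * A * V) ∈ heckeGroup p :=
    mul_mem (mul_mem (inv_mem hVmem) hA) hVmem
  have h10 : (V⁻¹ * A * V).1 1 0 = 0 := by
    rw [Matrix.SpecialLinearGroup.coe_mul, Matrix.SpecialLinearGroup.coe_mul,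
      Matrix.SpecialLinearGroup.coe_inv, Matrix.adjugate_fin_two, Matrix.eta_fin_two A.1]
    simp [Matrix.mul_apply, Fin.sum_univ_two, hcol, hs, hd]
    ring
  have htr : (V⁻¹ * A * V).1.trace = A.1.trace := by
    rw [Matrix.SpecialLinearGroup.coe_mul, Matrix.trace_mul_comm,
      ← Matrix.SpecialLinearGroup.coe_mul, mul_inv_cancel_left]
  have := abs_trace_eq_two_of_one_zero_eq_zero hp hmem h10
  rw [htr] at this
  linarith

theorem mul_mulVec_eq_smul {A B : SL(2, ℝ)} {x y : ℝ} {v : Fin 2 → ℝ}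
    (hA : A.1.mulVec v = x • v) (hB : B.1.mulVec v = y • v) :
    (A * B).1.mulVec v = (x * y) • v := by
  rw [Matrix.SpecialLinearGroup.coe_mul, ← Matrix.mulVec_mulVec, hB, Matrix.mulVec_smul, hA,
    smul_smul, mul_comm]

/-- For even `p` the geodesic from `-1` to `1` is the axis of a hyperbolic element of the Hecke
group. By discreteness, an element fixing `-1` commutes with that element. -/
theorem zero_zero_eq_one_one_of_even (hp : 3 ≤ p) (heven : Even p) {A : SL(2, ℝ)}
    (hA : toPSL A ∈ heckeGroup p) (hs : A.1 0 1 - A.1 1 0 = A.1 0 0 - A.1 1 1) :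
    A.1 0 0 = A.1 1 1 := by
  obtain ⟨k, hk⟩ := heven
  have hk : p = 2 * k := by omega
  have hdet := A.2
  rw [Matrix.det_fin_two] at hdet
  obtain ⟨W, hW⟩ : ∃ W, W = iotaMatrix⁻¹ * gammaMatrix p ^ k := ⟨_, rfl⟩
  have hWmem : toPSL W ∈ heckeGroup p := by
    rw [hW, toPSL_mul, toPSL_iotaMatrix_inv, ← coe_heckeIota (p := p), ← coe_heckeGamma_pow]
    exact mul_mem (SetLike.coe_mem _) (SetLike.coe_mem _)
  obtain ⟨S, C, hWSC, hS, hC⟩ : ∃ S C : ℝ, W.1 = !![S, C; C, S] ∧ 1 ≤ S ∧ 0 < C := by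
    have hS := one_le_sinRatio_half hp hk
    have hC := cos_pi_div_pos hp
    refine ⟨_, _, ?_, hS, mul_pos hC (one_pos.trans_le hS)⟩
    rw [hW, coe_iotaMatrix_inv_mul_gammaMatrix_pow hp, sinRatio_half_sub_one hp hk,
      sinRatio_half_add_one hp hk]
  have hWdet : (S - C) * (S + C) = 1 := by
    have := W.2
    rw [hWSC, Matrix.det_fin_two_of] at this
    linarith
  have hq0 : 0 < S - C := pos_of_mul_pos_left (hWdet ▸ one_pos) (by linarith)
  have hq1 : S - C < 1 := by nlinarith
  have hWinv : W⁻¹.1 = !![S, -C; -C, S] := by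
    rw [Matrix.SpecialLinearGroup.coe_inv, hWSC, Matrix.adjugate_fin_two]
    simp
  -- All matrices below have the eigenvector `(1, -1)`, which represents the boundary point `-1`.
  have hWv : W.1.mulVec ![1, -1] = (S - C) • ![1, -1] := by
    rw [hWSC]
    ext i
    fin_cases i <;> simp [Matrix.mulVec, dotProduct, sub_eq_add_neg]
  have hWv' : W⁻¹.1.mulVec ![1, -1] = (S + C) • ![1, -1] := by
    rw [hWinv]
    ext i
    fin_cases i <;> simp [Matrix.mulVec, dotProduct]
  have hAv : A.1.mulVec ![1, -1] = (A.1 1 1 - A.1 1 0) • ![1, -1] := by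
    ext i; fin_cases i <;> simp [Matrix.mulVec, dotProduct] <;> linarith
  have hAv' : A⁻¹.1.mulVec ![1, -1] = (A.1 0 0 + A.1 1 0) • ![1, -1] := by
    rw [Matrix.SpecialLinearGroup.coe_inv, Matrix.adjugate_fin_two]
    ext i; fin_cases i <;> simp [Matrix.mulVec, dotProduct] <;> linarith
  obtain ⟨U, hU⟩ : ∃ U, U = W * A * W⁻¹ * A⁻¹ := ⟨_, rfl⟩
  have hUv : U.1.mulVec ![1, -1] = (1 : ℝ) • ![1, -1] := by
    rw [hU]
    convert mul_mulVec_eq_smul (mul_mulVec_eq_smul (mul_mulVec_eq_smul hWv hAv) hWv') hAv' using 2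
    linear_combination
      (-(A.1 1 1 - A.1 1 0) * (A.1 0 0 + A.1 1 0)) * hWdet - hdet - A.1 1 0 * hs
  -- The conjugates of the unipotent matrix `U` by powers of `W` tend to the identity.
  have hseq (n : ℕ) : ∃ M : SL(2, ℝ), toPSL M ∈ heckeGroup p ∧
      M.1.mulVec ![1, -1] = (1 : ℝ) • ![1, -1] ∧ M.1 1 0 = ((S - C) ^ 2) ^ n * U.1 1 0 := by
    induction n with
    | zero =>
      refine ⟨U, ?_, hUv, by simp⟩
      rw [hU]
      exact mul_mem (mul_mem (mul_mem hWmem hA) (inv_mem hWmem)) (inv_mem hA)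
    | succ n ih =>
      obtain ⟨M, hM, hMv, hMn⟩ := ih
      refine ⟨W * M * W⁻¹, mul_mem (mul_mem hWmem hM) (inv_mem hWmem), ?_, ?_⟩
      · convert mul_mulVec_eq_smul (mul_mulVec_eq_smul hWv hMv) hWv' using 2
        linarith
      · have h0 := congrFun hMv 0
        have h1 := congrFun hMv 1
        have hMdet := M.2
        rw [Matrix.det_fin_two] at hMdet
        simp [Matrix.mulVec, dotProduct] at h0 h1
        have e0 : M.1 0 0 = 1 + M.1 0 1 := by linarith
        have e1 : M.1 1 1 = 1 + M.1 1 0 := by linarith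
        have e2 : M.1 0 1 = -M.1 1 0 := by
          rw [e0, e1] at hMdet
          linarith
        have hstep : (W * M * W⁻¹).1 1 0 = (S - C) ^ 2 * M.1 1 0 := by
          rw [Matrix.SpecialLinearGroup.coe_mul, Matrix.SpecialLinearGroup.coe_mul, hWinv, hWSC,
            Matrix.eta_fin_two M.1]
          simp [e0, e1, e2]
          ring
        rw [hstep, hMn]
        ring
  have hU0 : U.1 1 0 = 0 := by
    have hlim : Filter.Tendsto (fun n : ℕ => |((S - C) ^ 2) ^ n * U.1 1 0|) Filter.atTop
        (nhds 0) := by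
      have h1 : (S - C) ^ 2 < 1 := by nlinarith
      simpa using ((tendsto_pow_atTop_nhds_zero_of_lt_one (sq_nonneg _) h1).mul_const
        (U.1 1 0)).abs
    obtain ⟨n, hn⟩ := (hlim.eventually_lt_const one_pos).exists
    obtain ⟨M, hM, -, hMn⟩ := hseq n
    rw [← hMn] at hn
    have h := one_zero_eq_zero_of_abs_lt_one hp hM hn
    rw [hMn] at h
    exact (mul_eq_zero.1 h).resolve_left (by positivity)
  have hU1 : U = 1 := by
    have h0 := congrFun hUv 0
    have h1 := congrFun hUv 1
    have hUdet := U.2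
    rw [Matrix.det_fin_two] at hUdet
    simp [Matrix.mulVec, dotProduct] at h0 h1
    have e1 : U.1 1 1 = 1 := by linarith
    rw [e1, hU0] at hUdet
    have e0 : U.1 0 0 = 1 := by linarith
    have e2 : U.1 0 1 = 0 := by linarith
    apply Subtype.ext
    rw [Matrix.eta_fin_two U.1, e0, e1, e2, hU0]
    exact Matrix.one_fin_two.symm
  have hcomm : W * A = A * W := by
    rwa [hU, mul_inv_eq_one, mul_inv_eq_iff_eq_mul] at hU1
  have h := congrArg Subtype.val hcomm
  rw [Matrix.SpecialLinearGroup.coe_mul, Matrix.SpecialLinearGroup.coe_mul, hWSC] at h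
  have h := congrFun (congrFun h 1) 0
  simp [Matrix.mul_apply, Fin.sum_univ_two] at h
  apply mul_left_cancel₀ hC.ne'
  linarith

/-! ### Fixed-point ratios -/

theorem fixedPointRatio_toPSL_of_ne {A : SL(2, ℝ)} (h : A.1 0 0 ≠ A.1 1 1) :
    fixedPointRatio (toPSL A) = ((A.1 0 1 - A.1 1 0) / (A.1 0 0 - A.1 1 1) : ℝ) := by
  rw [fixedPointRatio_toPSL, matrixFixedPointRatio, if_pos h]

theorem fixedPointRatio_toPSL_of_eq {A : SL(2, ℝ)} (h : A.1 0 0 = A.1 1 1)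
    (hs : A.1 0 1 = A.1 1 0) : fixedPointRatio (toPSL A) = ((1 : ℝ) : OnePoint ℝ) := by
  rw [fixedPointRatio_toPSL, matrixFixedPointRatio, if_neg (not_not.2 h), if_neg (not_not.2 hs)]

theorem fixedPointRatio_toPSL_eq_coe {A : SL(2, ℝ)} {x : ℝ}
    (h : fixedPointRatio (toPSL A) = (x : OnePoint ℝ)) :
    A.1 0 1 - A.1 1 0 = x * (A.1 0 0 - A.1 1 1) ∧ (A.1 0 0 = A.1 1 1 → x = 1) := by
  by_cases hd : A.1 0 0 = A.1 1 1
  · rw [fixedPointRatio_toPSL, matrixFixedPointRatio, if_neg (not_not.2 hd)] at h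
    split_ifs at h with hs
    · exact absurd h (OnePoint.infty_ne_coe x)
    · rw [not_not] at hs
      exact ⟨by rw [hs, hd]; ring, fun _ => (OnePoint.coe_injective h).symm⟩
  · rw [fixedPointRatio_toPSL_of_ne hd] at h
    have h := OnePoint.coe_injective h
    rw [div_eq_iff (sub_ne_zero.2 hd)] at h
    exact ⟨h, fun h0 => absurd h0 hd⟩

theorem isReciprocal_of_sq_eq_one {G : Type*} [Group G] {g : G} (h : g ^ 2 = 1) :
    IsReciprocal g :=
  ⟨1, by rw [one_mul, inv_one, mul_one]; exact inv_eq_of_mul_eq_one_left (by rw [← pow_two, h])⟩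

/-- Up to conjugacy, a reciprocal element that is not an involution is a hyperbolic element with
reciprocator `ι` or `γ_p ^ (p / 2)`. -/
theorem exists_isConj_of_isReciprocal (hp : 3 ≤ p) {g : heckeGroup p} (hg : IsReciprocal g)
    (hsq : g ^ 2 ≠ 1) :
    ∃ h : heckeGroup p, ∃ A : SL(2, ℝ), toPSL A = h ∧ IsConj g h ∧
      IsHyperbolicPSL (h : PSL(2, ℝ)) ∧ (A.1 0 1 = A.1 1 0 ∨
        Even p ∧ A.1 0 1 - A.1 1 0 = Real.cos (Real.pi / p) * (A.1 0 0 - A.1 1 1)) := by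
  have hcoe {x : heckeGroup p} (hx : x ^ 2 ≠ 1) : (x : PSL(2, ℝ)) ^ 2 ≠ 1 :=
    fun h0 => hx (Subtype.ext h0)
  obtain ⟨r, hr⟩ := hg
  obtain ⟨A, hA⟩ := exists_toPSL_eq (g : PSL(2, ℝ))
  obtain ⟨R, hR⟩ := exists_toPSL_eq (r : PSL(2, ℝ))
  have htr := ((isHyperbolicPSL_of_inv_eq_conj (congrArg Subtype.val hr) (hcoe hsq)).2 A R hA hR).1
  rcases isConj_of_trace_eq_zero hp hR htr with h | ⟨k, hk, h⟩ <;>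
    obtain ⟨h, hgh, hh, hhsq⟩ := exists_isConj_inv_eq_conj hr h hsq <;>
    obtain ⟨B, hB⟩ := exists_toPSL_eq (h : PSL(2, ℝ)) <;>
    refine ⟨h, B, hB, hgh,
      (isHyperbolicPSL_of_inv_eq_conj (congrArg Subtype.val hh) (hcoe hhsq)).1, ?_⟩
  · exact .inl (symm_of_inv_eq_conj_heckeIota hB hh hhsq)
  · exact .inr ⟨⟨k, by omega⟩, sub_eq_cos_mul_of_inv_eq_conj_heckeGamma_pow hp hk hB hh hhsq⟩

theorem fixedPointRatio_eq_zero_iff_of_odd (hp : 3 ≤ p) (hodd : Odd p) {A : SL(2, ℝ)}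
    (hA : toPSL A ∈ heckeGroup p) (hhyp : 2 < |A.1.trace|) :
    fixedPointRatio (toPSL A) = ((0 : ℝ) : OnePoint ℝ) ↔ A.1 0 1 = A.1 1 0 := by
  constructor
  · intro h
    have := (fixedPointRatio_toPSL_eq_coe h).1
    linarith
  · intro h
    rw [fixedPointRatio_toPSL_of_ne (zero_zero_ne_one_one_of_odd hp hodd hA hhyp h), h]
    simp

theorem hasSymmetricLifts_toPSL {A : SL(2, ℝ)} :
    HasSymmetricLifts (toPSL A) ↔ A.1 0 1 = A.1 1 0 := by
  constructor
  · intro h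
    exact (h A rfl).apply 1 0
  · intro h B hB
    have hsymm : A.1.IsSymm := by
      ext i j
      fin_cases i <;> fin_cases j <;> simp [h]
    rcases toPSL_eq_iff.1 hB with rfl | rfl
    · exact hsymm
    · exact hsymm.neg

end Hecke

theorem theorem1p2 (p : ℕ) (hp : 3 ≤ p) :
    (Odd p →
      (∀ g : heckeGroup p,
        IsReciprocal g ↔
          (g ^ 2 = 1 ∨
            ∃ h : heckeGroup p, IsConj g h ∧ IsHyperbolicPSL (h : PSL(2, ℝ)) ∧
              fixedPointRatio (h : PSL(2, ℝ)) = ((0 : ℝ) : OnePoint ℝ))) ∧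
      (∀ h : heckeGroup p, IsHyperbolicPSL (h : PSL(2, ℝ)) →
        (fixedPointRatio (h : PSL(2, ℝ)) = ((0 : ℝ) : OnePoint ℝ) ↔
          HasSymmetricLifts (h : PSL(2, ℝ))))) ∧
    (Even p →
      (∀ g : heckeGroup p,
        IsReciprocal g ↔
          (g ^ 2 = 1 ∨
            ∃ h : heckeGroup p, IsConj g h ∧ IsHyperbolicPSL (h : PSL(2, ℝ)) ∧
              (fixedPointRatio (h : PSL(2, ℝ)) = ((0 : ℝ) : OnePoint ℝ) ∨
                fixedPointRatio (h : PSL(2, ℝ)) = ((1 : ℝ) : OnePoint ℝ) ∨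
                fixedPointRatio (h : PSL(2, ℝ)) =
                  ((Real.cos (Real.pi / p) : ℝ) : OnePoint ℝ)))) ∧
      (∀ g r : heckeGroup p, IsHyperbolicPSL (g : PSL(2, ℝ)) → g⁻¹ = r * g * r⁻¹ →
        (IsConj r (heckeIota p) ∨ IsConj r (heckeGamma p ^ (p / 2))))) := by
  refine ⟨fun hodd => ⟨fun g => ⟨fun hg => ?_, ?_⟩, fun h hhyp => ?_⟩,
    fun heven => ⟨fun g => ⟨fun hg => ?_, ?_⟩, fun g r hhyp hr => ?_⟩⟩
  · refine or_iff_not_imp_left.2 fun hsq => ?_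
    obtain ⟨h, A, hA, hgh, hhyp, hs⟩ := exists_isConj_of_isReciprocal hp hg hsq
    refine ⟨h, hgh, hhyp, ?_⟩
    have hs := hs.resolve_right fun h => (Nat.not_even_iff_odd.2 hodd) h.1
    rw [← hA]
    exact (fixedPointRatio_eq_zero_iff_of_odd hp hodd (hA ▸ h.2) (hhyp A hA)).2 hs
  · rintro (h | ⟨h, hgh, -, h0⟩)
    · exact isReciprocal_of_sq_eq_one h
    · obtain ⟨A, hA⟩ := exists_toPSL_eq (h : PSL(2, ℝ))
      rw [← hA] at h0
      have := (fixedPointRatio_toPSL_eq_coe h0).1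
      exact (isReciprocal_of_symm hA (by linarith)).of_isConj hgh
  · obtain ⟨A, hA⟩ := exists_toPSL_eq (h : PSL(2, ℝ))
    rw [← hA, hasSymmetricLifts_toPSL]
    exact fixedPointRatio_eq_zero_iff_of_odd hp hodd (hA ▸ h.2) (hhyp A hA)
  · refine or_iff_not_imp_left.2 fun hsq => ?_
    obtain ⟨h, A, hA, hgh, hhyp, hs⟩ := exists_isConj_of_isReciprocal hp hg hsq
    refine ⟨h, hgh, hhyp, ?_⟩
    rw [← hA]
    by_cases hd : A.1 0 0 = A.1 1 1
    · refine .inr (.inl (fixedPointRatio_toPSL_of_eq hd ?_))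
      rcases hs with hs | ⟨-, hs⟩
      · exact hs
      · rw [hd, sub_self, mul_zero] at hs
        linarith
    · rw [fixedPointRatio_toPSL_of_ne hd]
      rcases hs with hs | ⟨-, hs⟩
      · exact .inl (congrArg _ (by rw [hs, sub_self, zero_div]))
      · exact .inr (.inr (congrArg _ (by rw [hs, mul_div_cancel_right₀ _ (sub_ne_zero.2 hd)])))
  -- The ratio `1` covers symmetric matrices with `a = d`; if `a ≠ d` it would say that `h` fixes
  -- `-1`, which discreteness rules out.
  · rintro (h | ⟨h, hgh, -, hθ⟩)
    · exact isReciprocal_of_sq_eq_one h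
    · obtain ⟨A, hA⟩ := exists_toPSL_eq (h : PSL(2, ℝ))
      rw [← hA] at hθ
      refine IsReciprocal.of_isConj ?_ hgh
      rcases hθ with hθ | hθ | hθ <;> have hs := (fixedPointRatio_toPSL_eq_coe hθ).1
      · exact isReciprocal_of_symm hA (by linarith)
      · rw [one_mul] at hs
        have hd := zero_zero_eq_one_one_of_even hp heven (hA ▸ h.2) hs
        exact isReciprocal_of_symm hA (by linarith)
      · obtain ⟨k, hk⟩ := heven
        exact isReciprocal_of_sub_eq_cos_mul hp (k := k) (by omega) hA hs
  · obtain ⟨A, hA⟩ := exists_toPSL_eq (g : PSL(2, ℝ))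
    obtain ⟨R, hR⟩ := exists_toPSL_eq (r : PSL(2, ℝ))
    have htr := ((isHyperbolicPSL_of_inv_eq_conj (congrArg Subtype.val hr)
      hhyp.sq_ne_one).2 A R hA hR).1
    rcases isConj_of_trace_eq_zero hp hR htr with h | ⟨k, hk, h⟩
    · exact .inl h
    · rw [show p / 2 = k by omega]
      exact .inr h
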